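/- Let $p$ be a prime, let $\mathbb F_q$ be a finite field with $q$ elements and of characteristic $p$, and let $k\ge 1$ and $n\ge 2$ be integers. If $p\nmid k$ and $q\ge k^3-3k^2+3k$, then every matrix $A\in M_n(\mathbb F_q)$ is a sum of two $k$-th powers, i.e., there exist $B,C\in M_n(\mathbb F_q)$ such that $A=B^k+C^k$. -/

import Mathlib

/-! The hypothesis on `q` says `q > (k - 1) ^ 3`. Scalar and nonscalar matrices need different
arguments.

Nonscalar `A` is similar to a matrix with any prescribed diagonal of the same trace
(`Matrix.exists_conj_diag_eq`). Take diagonal entries `β i ^ k + γ i ^ k` and split the matrix into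
a lower and an upper triangular part with diagonals `β ^ k` and `γ ^ k`. Each part is a `k`-th power
if its diagonal has at most one zero (`Matrix.exists_pow_eq_of_isUpperTriangular`, by Hensel
lifting). The trace condition asks for four `k`-th powers with a given sum (`exists_four_pow_eq`),
which Jacobi sum estimates supply.

For `a • 1` with `a ≠ 0`, pass to the extension `K` of degree `n`: it is large enough for `a` to be
a sum of two `k`-th powers there, and the regular representation carries this identity to matrices.
-/

section PowerSums

/-! ### Character sums and sums of `k`-th powers. -/

variable {F : Type*} [Field F] [Fintype F]

/-- The nontrivial complex multiplicative characters of `F` killed by `k`. -/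
noncomputable def torsionChars (F : Type*) [Field F] [Fintype F] (k : ℕ) :
    Finset (MulChar F ℂ) :=
  (Set.toFinite {χ : MulChar F ℂ | χ ^ k = 1 ∧ χ ≠ 1}).toFinset

theorem mem_torsionChars {k : ℕ} {χ : MulChar F ℂ} :
    χ ∈ torsionChars F k ↔ χ ^ k = 1 ∧ χ ≠ 1 := by
  simp [torsionChars]

theorem card_torsionChars_add_one_le {k : ℕ} (hk : 0 < k) :
    (torsionChars F k).card + 1 ≤ k := by
  classical
  have : Fintype (MulChar F ℂ) := Fintype.ofFinite _
  obtain ⟨e⟩ := MulChar.mulEquiv_units F ℂ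
  have : IsCyclic (MulChar F ℂ) := isCyclic_of_surjective e.symm e.symm.surjective
  have h1 : (1 : MulChar F ℂ) ∉ torsionChars F k := fun h => (mem_torsionChars.1 h).2 rfl
  rw [← Finset.card_cons h1]
  refine le_trans (Finset.card_le_card ?_) (IsCyclic.card_pow_eq_one_le (α := MulChar F ℂ) hk)
  intro χ hχ
  rw [Finset.mem_cons] at hχ
  rcases hχ with rfl | hχ
  · simp
  · simpa using (mem_torsionChars.1 hχ).1

/-- The sum of all nontrivial characters killed by `k`. -/
noncomputable def torsionCharSum (k : ℕ) (y : F) : ℂ := ∑ χ ∈ torsionChars F k, χ y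

theorem sum_torsionCharSum (k : ℕ) : ∑ y : F, torsionCharSum k y = 0 := by
  unfold torsionCharSum
  rw [Finset.sum_comm]
  exact Finset.sum_eq_zero fun χ hχ => MulChar.sum_eq_zero_of_ne_one (mem_torsionChars.1 hχ).2

/-- Characters of the quotient of `Fˣ` by its `k`-th powers separate points. -/
theorem exists_mulChar_apply_ne_one {k : ℕ} (y : Fˣ) (hy : ∀ x : Fˣ, x ^ k ≠ y) :
    ∃ χ : MulChar F ℂ, χ ^ k = 1 ∧ χ y ≠ 1 := by
  classical
  let H : Subgroup Fˣ := (powMonoidHom k : Fˣ →* Fˣ).range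
  have hyH : (QuotientGroup.mk y : Fˣ ⧸ H) ≠ 1 := by
    rw [Ne, QuotientGroup.eq_one_iff]
    rintro ⟨x, hx⟩
    exact hy x hx
  obtain ⟨φ, hφ⟩ := CommGroup.exists_apply_ne_one_of_hasEnoughRootsOfUnity (Fˣ ⧸ H) ℂ hyH
  refine ⟨MulChar.ofUnitHom (φ.comp (QuotientGroup.mk' H)), ?_, ?_⟩
  · ext u
    have hu : (QuotientGroup.mk u : Fˣ ⧸ H) ^ k = 1 := by
      rw [← QuotientGroup.mk_pow, QuotientGroup.eq_one_iff]
      exact ⟨u, rfl⟩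
    rw [MulChar.pow_apply_coe, MulChar.ofUnitHom_coe, MulChar.one_apply_coe, ← Units.val_pow_eq_pow_val]
    simp [← map_pow, hu]
  · rw [MulChar.ofUnitHom_coe]
    simpa using hφ

/-- Off zero the weight sums all characters killed by `k`. Multiplying by a `χ` with `χ y ≠ 1`
permutes them, so the sum vanishes when `y` is not a `k`-th power. -/
theorem exists_pow_eq_of_one_add_torsionCharSum_ne_zero {k : ℕ} (hk : 0 < k) {y : F}
    (h : 1 + torsionCharSum k y ≠ 0) : ∃ x, x ^ k = y := by
  classical
  rcases eq_or_ne y 0 with rfl | hy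
  · exact ⟨0, zero_pow hk.ne'⟩
  by_contra! hno
  apply h
  obtain ⟨χ, hχk, hχy⟩ := exists_mulChar_apply_ne_one (k := k) (Units.mk0 y hy)
    (fun x hx => hno x (by rw [← Units.val_pow_eq_pow_val, hx]; rfl))
  rw [Units.val_mk0] at hχy
  have h1 : (1 : MulChar F ℂ) ∉ torsionChars F k := fun h => (mem_torsionChars.1 h).2 rfl
  have hS : 1 + torsionCharSum k y = ∑ ψ ∈ Finset.cons 1 (torsionChars F k) h1, ψ y := by
    rw [Finset.sum_cons, MulChar.one_apply hy.isUnit]; rfl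
  have hmem : ∀ ψ, ψ ∈ Finset.cons 1 (torsionChars F k) h1 ↔ ψ ^ k = 1 := by
    intro ψ
    rw [Finset.mem_cons, mem_torsionChars]
    by_cases hψ : ψ = 1 <;> simp [hψ]
  rw [hS]
  have hinv : χ y * ∑ ψ ∈ Finset.cons 1 (torsionChars F k) h1, ψ y
      = ∑ ψ ∈ Finset.cons 1 (torsionChars F k) h1, ψ y := by
    rw [Finset.mul_sum]
    refine Finset.sum_bij' (fun ψ _ => χ * ψ) (fun ψ _ => χ⁻¹ * ψ) ?_ ?_ ?_ ?_ ?_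
    · intro ψ hψ
      rw [hmem] at hψ ⊢
      rw [mul_pow, hχk, hψ, one_mul]
    · intro ψ hψ
      rw [hmem] at hψ ⊢
      rw [mul_pow, inv_pow, hχk, hψ, inv_one, one_mul]
    · intro ψ _; simp
    · intro ψ _; simp
    · intro ψ _; simp
  have := sub_eq_zero.2 hinv
  rw [← sub_one_mul] at this
  exact (mul_eq_zero.1 this).resolve_left (sub_ne_zero.2 hχy)

theorem MulChar.norm_apply_le_one (χ : MulChar F ℂ) (y : F) : ‖χ y‖ ≤ 1 := by
  rcases eq_or_ne y 0 with rfl | hy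
  · simp
  have h : χ y * star (χ y) = 1 := by
    rw [MulChar.star_apply', ← MulChar.mul_apply, mul_inv_cancel, MulChar.one_apply hy.isUnit]
  have h2 : ‖χ y‖ * ‖χ y‖ = 1 := by
    have := congrArg norm h
    simpa using this
  nlinarith [norm_nonneg (χ y)]

theorem norm_jacobiSum_le {χ ψ : MulChar F ℂ} (hχ : χ ≠ 1) (hψ : ψ ≠ 1) :
    ‖jacobiSum χ ψ‖ ≤ √(Fintype.card F) := by
  have hq : (1 : ℝ) ≤ Fintype.card F := by exact_mod_cast Fintype.card_pos
  by_cases h : χ * ψ = 1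
  · rw [← inv_eq_of_mul_eq_one_right h, jacobiSum_nontrivial_inv hχ, norm_neg]
    exact (χ.norm_apply_le_one _).trans (Real.one_le_sqrt.2 hq)
  · have hc : ringChar ℂ ≠ ringChar F := by
      rw [ringChar.eq_zero]
      exact (CharP.ringChar_ne_zero_of_finite F).symm
    have h2 := jacobiSum_mul_jacobiSum_inv hc hχ hψ h
    have h3 : jacobiSum χ⁻¹ ψ⁻¹ = star (jacobiSum χ ψ) := by
      simp [jacobiSum, ← MulChar.star_apply']
    rw [h3] at h2
    have h4 := congrArg norm h2
    rw [norm_mul, norm_star, Complex.norm_natCast] at h4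
    exact Real.le_sqrt_of_sq_le (by rw [sq, h4])

theorem sum_mulChar_mul_apply_sub (χ ψ : MulChar F ℂ) {b : F} (hb : b ≠ 0) :
    ∑ y, χ y * ψ (b - y) = (χ * ψ) b * jacobiSum χ ψ := by
  rw [jacobiSum, ← Equiv.sum_comp (Equiv.mulLeft₀ b hb), Finset.mul_sum]
  refine Finset.sum_congr rfl fun y _ => ?_
  rw [Equiv.mulLeft₀_apply, show b - b * y = b * (1 - y) by ring, map_mul, map_mul,
    MulChar.mul_apply]
  ring

theorem sum_mulChar_mul_apply_neg (χ ψ : MulChar F ℂ) :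
    ∑ y, χ y * ψ (0 - y) = ψ (-1) * ∑ y, (χ * ψ) y := by
  rw [Finset.mul_sum]
  refine Finset.sum_congr rfl fun y _ => ?_
  rw [zero_sub, neg_eq_neg_one_mul, map_mul, MulChar.mul_apply]
  ring

/-- If `χ * ψ = 1`, the inner sum is `χ (-1)` times a point mass `q` at `0` minus `1`, and summing
against `φ` kills the constant. Otherwise the sum factors into two Jacobi sums, each at most `√q`.
-/
theorem norm_sum_three_mulChars_le {χ ψ φ : MulChar F ℂ} (hχ : χ ≠ 1) (hψ : ψ ≠ 1) (hφ : φ ≠ 1)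
    {a : F} (ha : a ≠ 0) :
    ‖∑ x, φ x * ∑ y, χ y * ψ (a - x - y)‖ ≤ Fintype.card F := by
  classical
  by_cases h : χ * ψ = 1
  · have hψχ : ψ = χ⁻¹ := (inv_eq_of_mul_eq_one_right h).symm
    have hK : ∀ b : F, ∑ y, χ y * ψ (b - y)
        = χ (-1) * ((if b = 0 then (Fintype.card F : ℂ) else 0) - 1) := by
      intro b
      rcases eq_or_ne b 0 with rfl | hb
      · rw [sum_mulChar_mul_apply_neg, h, MulChar.sum_one_eq_card_units, hψχ,
          MulChar.inv_apply', inv_neg_one, if_pos rfl, Fintype.card_units,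
          Nat.cast_sub Fintype.card_pos, Nat.cast_one]
      · rw [sum_mulChar_mul_apply_sub _ _ hb, h, MulChar.one_apply hb.isUnit, hψχ,
          jacobiSum_nontrivial_inv hχ, if_neg hb]
        ring
    have : ∑ x, φ x * ∑ y, χ y * ψ (a - x - y) = χ (-1) * (Fintype.card F * φ a) := by
      simp_rw [hK, sub_eq_zero]
      have : ∀ x, φ x * (χ (-1) * ((if a = x then (Fintype.card F : ℂ) else 0) - 1))
          = χ (-1) * ((if a = x then (Fintype.card F : ℂ) * φ x else 0)) - χ (-1) * φ x := by
        intro x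
        split_ifs <;> ring
      simp_rw [this]
      rw [Finset.sum_sub_distrib, ← Finset.mul_sum, ← Finset.mul_sum,
        MulChar.sum_eq_zero_of_ne_one hφ]
      simp
    rw [this, norm_mul, norm_mul, Complex.norm_natCast]
    calc ‖χ (-1)‖ * (Fintype.card F * ‖φ a‖) ≤ 1 * (Fintype.card F * 1) := by
          gcongr <;> exact MulChar.norm_apply_le_one _ _
      _ = Fintype.card F := by ring
  · have hK : ∀ b : F, ∑ y, χ y * ψ (b - y) = (χ * ψ) b * jacobiSum χ ψ := by
      intro b
      rcases eq_or_ne b 0 with rfl | hb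
      · rw [sum_mulChar_mul_apply_neg, MulChar.sum_eq_zero_of_ne_one h, MulChar.map_zero]
        ring
      · exact sum_mulChar_mul_apply_sub _ _ hb
    simp_rw [hK, ← mul_assoc]
    rw [← Finset.sum_mul, sum_mulChar_mul_apply_sub _ _ ha, norm_mul, norm_mul]
    calc ‖(φ * (χ * ψ)) a‖ * ‖jacobiSum φ (χ * ψ)‖ * ‖jacobiSum χ ψ‖
        ≤ 1 * √(Fintype.card F) * √(Fintype.card F) := by
          gcongr
          · exact MulChar.norm_apply_le_one _ _
          · exact norm_jacobiSum_le hφ h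
          · exact norm_jacobiSum_le hχ hψ
      _ = Fintype.card F := by rw [one_mul, Real.mul_self_sqrt (Nat.cast_nonneg _)]

/-- The self-convolution of `torsionCharSum k`. -/
noncomputable def torsionCharConv (k : ℕ) (b : F) : ℂ :=
  ∑ y : F, torsionCharSum k y * torsionCharSum k (b - y)

theorem torsionCharConv_eq (k : ℕ) (b : F) :
    torsionCharConv k b =
      ∑ χ ∈ torsionChars F k, ∑ ψ ∈ torsionChars F k, ∑ y, χ y * ψ (b - y) := by
  simp_rw [torsionCharConv, torsionCharSum, Finset.sum_mul_sum]
  rw [Finset.sum_comm]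
  exact Finset.sum_congr rfl fun χ _ => Finset.sum_comm

theorem sum_torsionCharConv (k : ℕ) : ∑ b : F, torsionCharConv k b = 0 := by
  simp_rw [torsionCharConv]
  rw [Finset.sum_comm]
  refine Finset.sum_eq_zero fun y _ => ?_
  rw [← Finset.mul_sum, show ∑ b, torsionCharSum k (b - y) = _ from
      Equiv.sum_comp (Equiv.subRight y) (torsionCharSum k), sum_torsionCharSum,
    mul_zero]

/-- The linear terms vanish since nontrivial characters sum to zero. -/
theorem sum_two_weights (k : ℕ) (b : F) :
    ∑ y : F, (1 + torsionCharSum k y) * (1 + torsionCharSum k (b - y))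
      = Fintype.card F + torsionCharConv k b := by
  have h : ∀ y : F, (1 + torsionCharSum k y) * (1 + torsionCharSum k (b - y))
      = 1 + torsionCharSum k y + torsionCharSum k (b - y)
        + torsionCharSum k y * torsionCharSum k (b - y) := fun y => by ring
  simp_rw [h, Finset.sum_add_distrib]
  rw [sum_torsionCharSum, show ∑ y, torsionCharSum k (b - y) = _ from
      Equiv.sum_comp (Equiv.subLeft b) (torsionCharSum k), sum_torsionCharSum,
    torsionCharConv]
  simp

theorem sum_three_weights (k : ℕ) (a : F) :
    ∑ x : F, (1 + torsionCharSum k x) *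
      ∑ y : F, (1 + torsionCharSum k y) * (1 + torsionCharSum k (a - x - y))
      = (Fintype.card F : ℂ) ^ 2 + ∑ x : F, torsionCharSum k x * torsionCharConv k (a - x) := by
  simp_rw [sum_two_weights]
  have h : ∀ x : F, (1 + torsionCharSum k x) * (Fintype.card F + torsionCharConv k (a - x))
      = Fintype.card F + torsionCharSum k x * Fintype.card F + torsionCharConv k (a - x)
        + torsionCharSum k x * torsionCharConv k (a - x) := fun y => by ring
  simp_rw [h, Finset.sum_add_distrib]
  rw [← Finset.sum_mul, sum_torsionCharSum, show ∑ x, torsionCharConv k (a - x) = _ from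
      Equiv.sum_comp (Equiv.subLeft a) (torsionCharConv k),
    sum_torsionCharConv]
  simp [sq]

theorem norm_torsionCharConv_le (k : ℕ) {a : F} (ha : a ≠ 0) :
    ‖torsionCharConv k a‖ ≤ ((torsionChars F k).card : ℝ) ^ 2 * √(Fintype.card F) := by
  rw [torsionCharConv_eq]
  have h : ∀ χ ∈ torsionChars F k, ∀ ψ ∈ torsionChars F k,
      ‖∑ y, χ y * ψ (a - y)‖ ≤ √(Fintype.card F) := by
    intro χ hχ ψ hψ
    rw [sum_mulChar_mul_apply_sub _ _ ha, norm_mul]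
    calc _ ≤ 1 * √(Fintype.card F) := by
          gcongr
          · exact MulChar.norm_apply_le_one _ _
          · exact norm_jacobiSum_le (mem_torsionChars.1 hχ).2 (mem_torsionChars.1 hψ).2
      _ = _ := one_mul _
  refine (norm_sum_le_of_le _ fun χ hχ => norm_sum_le_of_le _ (h χ hχ)).trans (le_of_eq ?_)
  simp only [Finset.sum_const, nsmul_eq_mul]
  ring

theorem norm_sum_torsionCharSum_mul_conv_le (k : ℕ) {a : F} (ha : a ≠ 0) :
    ‖∑ x : F, torsionCharSum k x * torsionCharConv k (a - x)‖
      ≤ ((torsionChars F k).card : ℝ) ^ 3 * Fintype.card F := by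
  have h : ∑ x : F, torsionCharSum k x * torsionCharConv k (a - x) =
      ∑ φ ∈ torsionChars F k, ∑ χ ∈ torsionChars F k, ∑ ψ ∈ torsionChars F k,
        ∑ x, φ x * ∑ y, χ y * ψ (a - x - y) := by
    simp_rw [torsionCharConv_eq, torsionCharSum, Finset.sum_mul]
    rw [Finset.sum_comm]
    refine Finset.sum_congr rfl fun φ _ => ?_
    simp_rw [Finset.mul_sum (torsionChars F k)]
    rw [Finset.sum_comm]
    exact Finset.sum_congr rfl fun χ _ => Finset.sum_comm
  rw [h]
  refine (norm_sum_le_of_le _ fun φ hφ => norm_sum_le_of_le _ fun χ hχ =>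
    norm_sum_le_of_le _ fun ψ hψ => norm_sum_three_mulChars_le (mem_torsionChars.1 hχ).2
      (mem_torsionChars.1 hψ).2 (mem_torsionChars.1 hφ).2 ha).trans (le_of_eq ?_)
  simp only [Finset.sum_const, nsmul_eq_mul]
  ring

theorem cast_card_torsionChars_le {k : ℕ} (hk : 0 < k) :
    ((torsionChars F k).card : ℝ) ≤ (k : ℝ) - 1 := by
  have h : (((torsionChars F k).card + 1 : ℕ) : ℝ) ≤ k :=
    Nat.cast_le.2 (card_torsionChars_add_one_le hk)
  push_cast at h
  linarith

/-- Nonzero elements of a finite field with more than `(k - 1) ^ 4` elements are sums of two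
`k`-th powers. -/
theorem exists_pow_add_pow_eq {k : ℕ} (hk : 0 < k)
    (hq : ((k : ℝ) - 1) ^ 4 < Fintype.card F) {a : F} (ha : a ≠ 0) :
    ∃ x y : F, x ^ k + y ^ k = a := by
  by_contra! hno
  have h0 : ∑ y : F, (1 + torsionCharSum k y) * (1 + torsionCharSum k (a - y)) = 0 := by
    refine Finset.sum_eq_zero fun y _ => ?_
    by_contra hne
    obtain ⟨u, hu⟩ := exists_pow_eq_of_one_add_torsionCharSum_ne_zero hk (left_ne_zero_of_mul hne)
    obtain ⟨v, hv⟩ := exists_pow_eq_of_one_add_torsionCharSum_ne_zero hk (right_ne_zero_of_mul hne)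
    exact hno u v (by rw [hu, hv]; ring)
  rw [sum_two_weights] at h0
  -- Without a representation the main term `q` equals the error in norm, which is at most `(k - 1)
  -- ^ 2 * √q`.
  have h1 : ((Fintype.card F : ℕ) : ℝ) = ‖torsionCharConv k a‖ := by
    rw [← norm_neg, ← eq_neg_of_add_eq_zero_left h0, Complex.norm_natCast]
  have h2 := norm_torsionCharConv_le k ha
  have hc := cast_card_torsionChars_le (F := F) hk
  have hs : ((k : ℝ) - 1) ^ 2 < √(Fintype.card F) := by
    apply Real.lt_sqrt_of_sq_lt
    calc _ = ((k : ℝ) - 1) ^ 4 := by ring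
      _ < _ := hq
  have hc0 : (0 : ℝ) ≤ (torsionChars F k).card := Nat.cast_nonneg _
  have hM : ((torsionChars F k).card : ℝ) ^ 2 ≤ ((k : ℝ) - 1) ^ 2 := by gcongr
  have hq0 : 0 < √(Fintype.card F : ℝ) := lt_of_le_of_lt (sq_nonneg _) hs
  have := Real.mul_self_sqrt (Nat.cast_nonneg (α := ℝ) (Fintype.card F))
  nlinarith

/-- Nonzero elements of a finite field with more than `(k - 1) ^ 3` elements are sums of three
`k`-th powers. -/
theorem exists_pow_add_pow_add_pow_eq {k : ℕ} (hk : 0 < k)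
    (hq : ((k : ℝ) - 1) ^ 3 < Fintype.card F) {a : F} (ha : a ≠ 0) :
    ∃ x y z : F, x ^ k + y ^ k + z ^ k = a := by
  by_contra! hno
  have h0 : ∑ x : F, (1 + torsionCharSum k x) *
      ∑ y : F, (1 + torsionCharSum k y) * (1 + torsionCharSum k (a - x - y)) = 0 := by
    simp_rw [Finset.mul_sum]
    refine Finset.sum_eq_zero fun x _ => Finset.sum_eq_zero fun y _ => ?_
    by_contra hne
    have hne' := right_ne_zero_of_mul hne
    obtain ⟨u, hu⟩ := exists_pow_eq_of_one_add_torsionCharSum_ne_zero hk (left_ne_zero_of_mul hne)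
    obtain ⟨v, hv⟩ := exists_pow_eq_of_one_add_torsionCharSum_ne_zero hk (left_ne_zero_of_mul hne')
    obtain ⟨w, hw⟩ := exists_pow_eq_of_one_add_torsionCharSum_ne_zero hk
      (right_ne_zero_of_mul hne')
    exact hno u v w (by rw [hu, hv, hw]; ring)
  rw [sum_three_weights] at h0
  have h1 : (Fintype.card F : ℝ) ^ 2
      = ‖∑ x : F, torsionCharSum k x * torsionCharConv k (a - x)‖ := by
    rw [← norm_neg, ← eq_neg_of_add_eq_zero_left h0, norm_pow, Complex.norm_natCast]
  have h2 := norm_sum_torsionCharSum_mul_conv_le k ha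
  have hc := cast_card_torsionChars_le (F := F) hk
  have hc0 : (0 : ℝ) ≤ (torsionChars F k).card := Nat.cast_nonneg _
  have hM : ((torsionChars F k).card : ℝ) ^ 3 ≤ ((k : ℝ) - 1) ^ 3 := by gcongr
  have hq0 : (0 : ℝ) < Fintype.card F := by exact_mod_cast Fintype.card_pos
  nlinarith

end PowerSums

/-! ### `k`-th roots of triangular matrices. -/

section TriangularRoots

open Polynomial

variable {F : Type*} [Field F]

theorem isCoprime_X_prod_X_sub_C {ι : Type*} (s : Finset ι) (l : ι → F)
    (hl : ∀ i ∈ s, l i ≠ 0) : IsCoprime (X : F[X]) (∏ i ∈ s, (X - C (l i))) := by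
  refine IsCoprime.prod_right fun i hi => ?_
  have := pairwise_coprime_X_sub_C (K := F) (s := id) Function.injective_id (hl i hi).symm
  simpa [Function.onFun] using this

/-- Interpolation gives a root of `T ^ k - X` modulo nilpotents in `F[X] / (g)`. As `k` and `X` are
units there, Newton iteration makes it exact. -/
theorem exists_prod_X_sub_C_dvd_pow_sub_X [Finite F] {ι : Type*} {k : ℕ} (hk : (k : F) ≠ 0)
    (s : Finset ι) (l : ι → F) (hl : ∀ i ∈ s, l i ≠ 0 ∧ ∃ m, m ^ k = l i) :
    ∃ r : F[X], (∏ i ∈ s, (X - C (l i))) ∣ r ^ k - X := by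
  classical
  have := Fintype.ofFinite F
  have hk0 : k ≠ 0 := by rintro rfl; simp at hk
  set g : F[X] := ∏ i ∈ s, (X - C (l i)) with hg
  let μ : F → F := fun y => if h : ∃ m, m ^ k = y then h.choose else 0
  have hμ : ∀ i ∈ s, μ (l i) ^ k = l i := by
    intro i hi
    have h := (hl i hi).2
    simp only [μ, dif_pos h]
    exact h.choose_spec
  -- Interpolating on all of `F` avoids trouble with repeated values of `l`.
  let r₀ : F[X] := Lagrange.interpolate Finset.univ id μ
  have hr₀ : ∀ y, r₀.eval y = μ y := fun y =>
    Lagrange.eval_interpolate_at_node μ Function.injective_id.injOn (Finset.mem_univ y)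
  have hdvd : g ∣ (r₀ ^ k - X) ^ s.card := by
    rw [hg, ← Finset.prod_const]
    refine Finset.prod_dvd_prod_of_dvd _ _ fun i hi => ?_
    rw [dvd_iff_isRoot, IsRoot, eval_sub, eval_pow, hr₀, hμ i hi, eval_X, sub_self]
  let x : AdjoinRoot g := AdjoinRoot.mk g r₀
  have hnil : IsNilpotent (x ^ k - AdjoinRoot.mk g X) :=
    ⟨s.card, by
      rw [← map_pow, ← map_sub, ← map_pow]
      exact AdjoinRoot.mk_eq_zero.2 hdvd⟩
  have hXu : IsUnit (AdjoinRoot.mk g X) := by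
    obtain ⟨u, v, huv⟩ := isCoprime_X_prod_X_sub_C s l fun i hi => (hl i hi).1
    refine IsUnit.of_mul_eq_one (AdjoinRoot.mk g u) ?_
    have := congrArg (AdjoinRoot.mk g) huv
    rwa [map_add, map_mul, map_mul, ← hg, AdjoinRoot.mk_self, mul_zero, add_zero, map_one,
      mul_comm] at this
  have hxu : IsUnit x := by
    have : IsUnit (x ^ k) := by
      have := hnil.isUnit_add_left_of_commute hXu (Commute.all _ _)
      simpa using this
    exact (isUnit_pow_iff hk0).1 this
  let P : (AdjoinRoot g)[X] := X ^ k - C (AdjoinRoot.mk g X)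
  have hku : IsUnit ((k : ℕ) : AdjoinRoot g) := by
    have := (IsUnit.mk0 _ hk).map (algebraMap F (AdjoinRoot g))
    simpa using this
  obtain ⟨y, ⟨-, hy⟩, -⟩ := existsUnique_nilpotent_sub_and_aeval_eq_zero (P := P) (x := x)
    (by simpa [P] using hnil) (by simpa [P, derivative_X_pow] using And.intro hku (hxu.pow (k - 1)))
  obtain ⟨r, rfl⟩ := AdjoinRoot.mk_surjective y
  refine ⟨r, AdjoinRoot.mk_eq_zero.1 ?_⟩
  simpa [P] using hy

/-- Chinese remaindering: `u * X` is `0` modulo `X` and `1` modulo `g`. This admits a simple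
eigenvalue `0`. -/
theorem exists_X_mul_dvd_pow_sub_X {k : ℕ} (hk : k ≠ 0) {g r : F[X]} (hg : IsCoprime X g)
    (hr : g ∣ r ^ k - X) : ∃ t : F[X], X * g ∣ t ^ k - X := by
  obtain ⟨u, v, huv⟩ := id hg
  refine ⟨r * (u * X), hg.mul_dvd ?_ ?_⟩
  · exact dvd_sub (dvd_pow (Dvd.intro_left (r * u) (by ring)) hk) dvd_rfl
  · have h1 : g ∣ r * (u * X) - r := ⟨-(r * v), by linear_combination r * huv⟩
    have h2 := (h1.trans (sub_dvd_pow_sub_pow _ _ k)).add hr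
    simpa using h2

theorem Matrix.exists_pow_eq_of_isUpperTriangular [Finite F] {n k : ℕ} (hk : (k : F) ≠ 0)
    {M : Matrix (Fin n) (Fin n) F} (hM : M.IsUpperTriangular) (i₀ : Fin n)
    (hpow : ∀ i, ∃ m, m ^ k = M i i) (hne : ∀ i, i ≠ i₀ → M i i ≠ 0) :
    ∃ B : Matrix (Fin n) (Fin n) F, B ^ k = M := by
  have hk0 : k ≠ 0 := by rintro rfl; simp at hk
  obtain ⟨r, hr⟩ : ∃ r : F[X], M.charpoly ∣ r ^ k - X := by
    rw [Matrix.charpoly_of_isUpperTriangular M hM]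
    by_cases h : M i₀ i₀ = 0
    · rw [← Finset.mul_prod_erase _ _ (Finset.mem_univ i₀), h, map_zero, sub_zero]
      obtain ⟨r, hr⟩ := exists_prod_X_sub_C_dvd_pow_sub_X hk (Finset.univ.erase i₀)
        (fun i => M i i) (fun i hi => ⟨hne i (Finset.ne_of_mem_erase hi), hpow i⟩)
      exact exists_X_mul_dvd_pow_sub_X hk0
        (isCoprime_X_prod_X_sub_C _ _ fun i hi => hne i (Finset.ne_of_mem_erase hi)) hr
    · refine exists_prod_X_sub_C_dvd_pow_sub_X hk Finset.univ (fun i => M i i)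
        (fun i _ => ⟨?_, hpow i⟩)
      by_cases hi : i = i₀
      · rwa [hi]
      · exact hne i hi
  refine ⟨aeval M r, sub_eq_zero.1 ?_⟩
  obtain ⟨t, ht⟩ := hr
  have := congrArg (aeval M) ht
  simpa [Matrix.aeval_self_charpoly] using this

end TriangularRoots

/-! ### Similarity to a matrix with prescribed diagonal. -/

section PrescribedDiagonal

variable {F : Type*} [Field F]

theorem exists_basis_extending_pair {V : Type*} [AddCommGroup V] [Module F V] {n : ℕ}
    (hV : Module.finrank F V = n + 2) {u v : V} (huv : LinearIndependent F ![u, v]) :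
    ∃ b : Module.Basis (Fin (n + 2)) F V, b 0 = u ∧ b 1 = v := by
  have key : ∀ j, j ≤ n → ∃ w : Fin (j + 2) → V, LinearIndependent F w ∧ w 0 = u ∧ w 1 = v := by
    intro j
    induction j with
    | zero => exact fun _ => ⟨![u, v], huv, rfl, rfl⟩
    | succ j ih =>
      intro hj
      obtain ⟨w, hw, h0, h1⟩ := ih (by omega)
      obtain ⟨x, hx⟩ := exists_linearIndependent_snoc_of_lt_finrank hw (by omega)
      refine ⟨_, hx, ?_, ?_⟩
      · rw [← h0]; exact Fin.snoc_castSucc (α := fun _ => V) x w 0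
      · rw [← h1]; exact Fin.snoc_castSucc (α := fun _ => V) x w 1
  obtain ⟨w, hw, h0, h1⟩ := key n le_rfl
  refine ⟨basisOfLinearIndependentOfCardEqFinrank hw (by simp [hV]), ?_, ?_⟩ <;> simpa

namespace Matrix

/-- A nonscalar matrix is similar to one whose first column is `(c, 1, 0, …, 0)`. -/
theorem exists_conj_first_column {n : ℕ} (A : Matrix (Fin (n + 2)) (Fin (n + 2)) F)
    (hA : ∀ a : F, A ≠ a • 1) (c : F) :
    ∃ P : (Matrix (Fin (n + 2)) (Fin (n + 2)) F)ˣ, ∀ i,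
      (P.val * A * P⁻¹.val) i 0
        = if i = 0 then c else if i = 1 then 1 else 0 := by
  obtain ⟨v, hv⟩ : ∃ v, LinearIndependent F ![v, Matrix.toLin' A v] := by
    by_contra! h
    obtain ⟨a, ha⟩ := LinearMap.exists_eq_smul_id_of_forall_notLinearIndependent h
    refine hA a ?_
    have := congrArg LinearMap.toMatrix' ha
    simpa using this
  -- In a basis starting with `v`, `A v - c v`, the first column is as required.
  have hv' : LinearIndependent F ![v, Matrix.toLin' A v - c • v] := by
    rw [LinearIndependent.pair_iff] at hv ⊢
    intro s t hst
    have := hv (s - t * c) t (by rw [← hst]; module)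
    obtain ⟨h1, h2⟩ := this
    rw [h2] at h1
    simpa [h2] using h1
  obtain ⟨b, h0, h1⟩ := exists_basis_extending_pair (n := n) (by simp) hv'
  let e := Pi.basisFun F (Fin (n + 2))
  refine ⟨⟨b.toMatrix e, e.toMatrix b, Module.Basis.toMatrix_mul_toMatrix_flip _ _,
    Module.Basis.toMatrix_mul_toMatrix_flip _ _⟩, fun i => ?_⟩
  have hAe : LinearMap.toMatrix e e (Matrix.toLin' A) = A := by
    rw [← Matrix.toLin_eq_toLin', LinearMap.toMatrix_toLin]
  have hconj := basis_toMatrix_mul_linearMap_toMatrix_mul_basis_toMatrix b e b e (Matrix.toLin' A)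
  rw [hAe] at hconj
  change (b.toMatrix e * A * e.toMatrix b) i 0 = _
  rw [hconj, LinearMap.toMatrix_apply, h0]
  have hcol : Matrix.toLin' A v = c • b 0 + b 1 := by rw [h0, h1]; abel
  rw [hcol]
  rcases eq_or_ne i 0 with rfl | hi
  · simp
  · simp [Finsupp.single_apply, hi, eq_comm]

/-- A nonscalar matrix of size at least three is similar to one with prescribed upper left entry
and nonscalar complementary block. -/
theorem exists_conj_corner {n : ℕ} (A : Matrix (Fin (n + 3)) (Fin (n + 3)) F)
    (hA : ∀ a : F, A ≠ a • 1) (c : F) :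
    ∃ P : (Matrix (Fin (n + 3)) (Fin (n + 3)) F)ˣ,
      (P.val * A * P⁻¹.val) 0 0 = c ∧
      ∀ a : F, (P.val * A * P⁻¹.val).submatrix Fin.succ Fin.succ
        ≠ a • 1 := by
  obtain ⟨P, hP⟩ : ∃ P : (Matrix (Fin (n + 3)) (Fin (n + 3)) F)ˣ, _ :=
    exists_conj_first_column A hA c
  by_cases h : ∀ a : F, (P.val * A * P⁻¹.val).submatrix
      Fin.succ Fin.succ ≠ a • 1
  · exact ⟨P, by simpa using hP 0, h⟩
  push Not at h
  obtain ⟨a, ha⟩ := h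
  have h02 : (0 : Fin (n + 3)) ≠ 2 := by simp [Fin.ext_iff, Nat.mod_eq_of_lt]
  have h12 : (1 : Fin (n + 3)) ≠ 2 := by simp [Fin.ext_iff, Nat.mod_eq_of_lt]
  -- If the block is scalar, this conjugation keeps the corner `c` but turns the `(1, 2)` entry from
  -- `0` into `1`.
  let T : (Matrix (Fin (n + 3)) (Fin (n + 3)) F)ˣ :=
    ⟨transvection 0 2 (-1), transvection 0 2 1,
      by rw [transvection_mul_transvection_same 0 2 h02]; simp,
      by rw [transvection_mul_transvection_same 0 2 h02]; simp⟩
  set M := P.val * A * P⁻¹.val with hM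
  have hconj : (T * P).val * A *
      (T * P)⁻¹.val = transvection 0 2 (-1) * M * transvection 0 2 1 := by
    rw [hM, _root_.mul_inv_rev, Units.val_mul, Units.val_mul]
    simp only [T, mul_assoc]
    rfl
  refine ⟨T * P, ?_, fun a' ha' => ?_⟩
  · rw [hconj, mul_transvection_apply_of_ne 0 2 _ _ h02, transvection_mul_apply_same, hP, hP]
    simp [h02.symm, h12.symm]
  · have h1 := congrFun (congrFun ha' 0) 1
    have h2 := congrFun (congrFun ha 0) 1
    rw [hconj] at h1
    simp only [submatrix_apply, smul_apply, Matrix.one_apply, Fin.succ_zero_eq_one,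
      Fin.succ_one_eq_two] at h1 h2
    rw [mul_transvection_apply_same, transvection_mul_apply_of_ne 0 2 _ _ one_ne_zero,
      transvection_mul_apply_of_ne 0 2 _ _ one_ne_zero, hP, h2] at h1
    simp at h1

/-- The block diagonal matrix with blocks `1` and `Q`. -/
def oneCons {n : ℕ} (Q : Matrix (Fin n) (Fin n) F) : Matrix (Fin (n + 1)) (Fin (n + 1)) F :=
  Matrix.of (Fin.cons (Fin.cons 1 fun _ => 0) fun i => Fin.cons 0 (Q i))

theorem oneCons_mul_oneCons {n : ℕ} (Q R : Matrix (Fin n) (Fin n) F) :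
    oneCons Q * oneCons R = oneCons (Q * R) := by
  ext i j
  refine Fin.cases ?_ (fun i => ?_) i <;> refine Fin.cases ?_ (fun j => ?_) j <;>
    simp [oneCons, Matrix.mul_apply, Fin.sum_univ_succ]

theorem oneCons_one {n : ℕ} : oneCons (1 : Matrix (Fin n) (Fin n) F) = 1 := by
  ext i j
  refine Fin.cases ?_ (fun i => ?_) i <;> refine Fin.cases ?_ (fun j => ?_) j <;>
    simp [oneCons, Matrix.one_apply, (Fin.succ_ne_zero _).symm]

theorem oneCons_mul_mul_oneCons_zero {n : ℕ} (Q R : Matrix (Fin n) (Fin n) F)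
    (M : Matrix (Fin (n + 1)) (Fin (n + 1)) F) : (oneCons Q * M * oneCons R) 0 0 = M 0 0 := by
  simp [oneCons, Matrix.mul_apply, Fin.sum_univ_succ]

theorem oneCons_mul_mul_oneCons_succ {n : ℕ} (Q R : Matrix (Fin n) (Fin n) F)
    (M : Matrix (Fin (n + 1)) (Fin (n + 1)) F) (i : Fin n) :
    (oneCons Q * M * oneCons R) i.succ i.succ
      = (Q * M.submatrix Fin.succ Fin.succ * R) i i := by
  simp [oneCons, Matrix.mul_apply, Fin.sum_univ_succ]

theorem trace_units_conj_eq {n : ℕ} (P : (Matrix (Fin n) (Fin n) F)ˣ)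
    (A : Matrix (Fin n) (Fin n) F) :
    (P.val * A * P⁻¹.val).trace = A.trace := by
  rw [Matrix.trace_mul_comm, ← mul_assoc, Units.inv_mul, one_mul]

/-- A nonscalar matrix is similar to one with any prescribed diagonal of the same trace. -/
theorem exists_conj_diag_eq {n : ℕ} (A : Matrix (Fin (n + 2)) (Fin (n + 2)) F)
    (hA : ∀ a : F, A ≠ a • 1) (d : Fin (n + 2) → F) (hd : ∑ i, d i = A.trace) :
    ∃ P : (Matrix (Fin (n + 2)) (Fin (n + 2)) F)ˣ,
      ∀ i, (P.val * A * P⁻¹.val) i i = d i := by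
  induction n with
  | zero =>
    obtain ⟨P, hP⟩ := exists_conj_first_column A hA (d 0)
    have h0 := hP 0
    rw [if_pos rfl] at h0
    have ht := trace_units_conj_eq P A
    rw [← hd, Matrix.trace, Fin.sum_univ_two, Fin.sum_univ_two, diag_apply, diag_apply, h0,
      add_right_inj] at ht
    exact ⟨P, Fin.forall_fin_two.2 ⟨h0, ht⟩⟩
  | succ n ih =>
    obtain ⟨P, hP0, hP⟩ := exists_conj_corner A hA (d 0)
    have ht := trace_units_conj_eq P A
    set M := P.val * A * P⁻¹.val with hM
    obtain ⟨Q, hQ⟩ := ih (M.submatrix Fin.succ Fin.succ) hP (fun i => d i.succ) (by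
      rw [← hd, Matrix.trace, Fin.sum_univ_succ, Fin.sum_univ_succ (f := d), diag_apply, hP0,
        add_right_inj] at ht
      exact ht.symm)
    let Q' : (Matrix (Fin (n + 1 + 2)) (Fin (n + 1 + 2)) F)ˣ :=
      ⟨oneCons Q.val, oneCons Q⁻¹.val,
        by rw [oneCons_mul_oneCons, Units.mul_inv, oneCons_one],
        by rw [oneCons_mul_oneCons, Units.inv_mul, oneCons_one]⟩
    have hconj : (Q' * P).val * A *
        (Q' * P)⁻¹.val
        = oneCons Q.val * M * oneCons Q⁻¹.val := by
      rw [hM, _root_.mul_inv_rev, Units.val_mul, Units.val_mul]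
      simp only [Q', mul_assoc]
      rfl
    refine ⟨Q' * P, Fin.cases ?_ fun i => ?_⟩
    · rw [hconj, oneCons_mul_mul_oneCons_zero, hP0]
    · rw [hconj, oneCons_mul_mul_oneCons_succ, hQ]

end Matrix

end PrescribedDiagonal

/-! ### Assembling the decomposition. -/

section Main

variable {F : Type*} [Field F] [Fintype F]

theorem exists_pow_eq_ne_one {k : ℕ} (hk : 0 < k) (hq : k + 1 < Fintype.card F) :
    ∃ w : F, w ≠ 0 ∧ w ^ k ≠ 1 := by
  classical
  by_contra! h
  have hsub : Finset.univ.erase (0 : F) ⊆ (Polynomial.nthRootsFinset k (1 : F)) := by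
    intro w hw
    exact (Polynomial.mem_nthRootsFinset hk _).2 (h w (Finset.ne_of_mem_erase hw))
  have h1 := Finset.card_le_card hsub
  have h2 : (Polynomial.nthRootsFinset k (1 : F)).card ≤ k :=
    (Multiset.toFinset_card_le _).trans (Polynomial.card_nthRoots k 1)
  rw [Finset.card_erase_of_mem (Finset.mem_univ _), Finset.card_univ] at h1
  omega

/-- Every element of `F` is a sum of four `k`-th powers, two of them nonzero. -/
theorem exists_four_pow_eq {k : ℕ} (hk : 2 ≤ k) (hkF : (k : F) ≠ 0)
    (hq : (k - 1) ^ 3 < Fintype.card F) (t : F) :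
    ∃ x y z w : F, x ≠ 0 ∧ w ≠ 0 ∧ x ^ k + y ^ k + z ^ k + w ^ k = t := by
  have hk0 : k ≠ 0 := by omega
  have hqR : ((k : ℝ) - 1) ^ 3 < Fintype.card F := by
    have : (((k - 1) ^ 3 : ℕ) : ℝ) < Fintype.card F := Nat.cast_lt.2 hq
    rwa [Nat.cast_pow, Nat.cast_sub (by omega), Nat.cast_one] at this
  -- Three powers represent the nonzero `t - w ^ k`; one of them is nonzero and can be moved to `x`.
  have key : ∀ w : F, w ≠ 0 → w ^ k ≠ t →
      ∃ x y z w : F, x ≠ 0 ∧ w ≠ 0 ∧ x ^ k + y ^ k + z ^ k + w ^ k = t := by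
    intro w hw hwt
    obtain ⟨x, y, z, h⟩ := exists_pow_add_pow_add_pow_eq (by omega) hqR
      (sub_ne_zero.2 hwt.symm)
    by_cases hx : x = 0
    · by_cases hy : y = 0
      · have hz : z ≠ 0 := by
          rintro rfl
          rw [hx, hy, zero_pow hk0] at h
          exact sub_ne_zero.2 hwt.symm (by rw [← h]; ring)
        exact ⟨z, y, x, w, hz, hw, by linear_combination h⟩
      · exact ⟨y, x, z, w, hy, hw, by linear_combination h⟩
    · exact ⟨x, y, z, w, hx, hw, by linear_combination h⟩
  -- Only `t = 1` rules out `w = 1`. Then another `w` exists unless `q ≤ k + 1`, which forces `k =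
  -- 2`, `q = 3`, where `1 = 1 + 1 + 1 + 1`.
  by_cases ht : t = 1
  · by_cases hc : k + 1 < Fintype.card F
    · obtain ⟨w, hw, hw1⟩ := exists_pow_eq_ne_one (F := F) (by omega) hc
      exact key w hw (by rwa [ht])
    · have hk2 : k = 2 := by
        by_contra hne
        obtain ⟨m, rfl⟩ : ∃ m, k = m + 3 := ⟨k - 3, by omega⟩
        rw [show m + 3 - 1 = m + 2 by omega] at hq
        have : m + 4 ≤ (m + 2) ^ 3 := by nlinarith [sq_nonneg m, Nat.zero_le (m ^ 3)]
        omega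
      subst hk2
      have hcard : Fintype.card F = 3 := by
        have h1 : Fintype.card F ≠ 2 := by
          intro h2
          have := FiniteField.cast_card_eq_zero F
          rw [h2] at this
          exact hkF this
        simp at hq
        omega
      have h3 : (3 : F) = 0 := by
        have := FiniteField.cast_card_eq_zero F
        rw [hcard] at this
        exact_mod_cast this
      exact ⟨1, 1, 1, 1, one_ne_zero, one_ne_zero, by rw [ht]; linear_combination h3⟩
  · exact key 1 one_ne_zero (by rw [one_pow]; exact Ne.symm ht)

theorem Matrix.eq_pow_add_pow_of_diag_eq {n k : ℕ} (hk : (k : F) ≠ 0)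
    (A : Matrix (Fin n) (Fin n) F) (β γ : Fin n → F) (i₀ j₀ : Fin n)
    (hβ : ∀ i, i ≠ i₀ → β i ≠ 0) (hγ : ∀ j, j ≠ j₀ → γ j ≠ 0)
    (hA : ∀ i, A i i = β i ^ k + γ i ^ k) :
    ∃ B C : Matrix (Fin n) (Fin n) F, A = B ^ k + C ^ k := by
  -- `L` is the transpose of the lower part, so that the upper triangular lemma applies to both.
  let L : Matrix (Fin n) (Fin n) F :=
    Matrix.of fun i j => if i < j then A j i else if i = j then β i ^ k else 0
  let U : Matrix (Fin n) (Fin n) F :=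
    Matrix.of fun i j => if i < j then A i j else if i = j then γ i ^ k else 0
  have hL : L.IsUpperTriangular := by
    intro i j hij
    have hij : j < i := hij
    simp [L, hij.not_gt, hij.ne']
  have hU : U.IsUpperTriangular := by
    intro i j hij
    have hij : j < i := hij
    simp [U, hij.not_gt, hij.ne']
  obtain ⟨B, hB⟩ := Matrix.exists_pow_eq_of_isUpperTriangular hk hL i₀
    (fun i => ⟨β i, by simp [L]⟩) (fun i hi => by simpa [L] using pow_ne_zero k (hβ i hi))
  obtain ⟨C, hC⟩ := Matrix.exists_pow_eq_of_isUpperTriangular hk hU j₀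
    (fun i => ⟨γ i, by simp [U]⟩) (fun i hi => by simpa [U] using pow_ne_zero k (hγ i hi))
  refine ⟨B.transpose, C, ?_⟩
  rw [← Matrix.transpose_pow, hB, hC]
  ext i j
  rcases lt_trichotomy i j with h | rfl | h
  · simp [L, U, h, h.not_gt, h.ne']
  · simp [L, U, hA]
  · simp [L, U, h, h.not_gt, h.ne']

theorem Matrix.exists_eq_pow_add_pow_of_not_scalar {n k : ℕ} (hk : 2 ≤ k) (hkF : (k : F) ≠ 0)
    (hq : (k - 1) ^ 3 < Fintype.card F) (A : Matrix (Fin (n + 2)) (Fin (n + 2)) F)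
    (hA : ∀ a : F, A ≠ a • 1) :
    ∃ B C : Matrix (Fin (n + 2)) (Fin (n + 2)) F, A = B ^ k + C ^ k := by
  -- The other `n` diagonal entries will be `1 ^ k + 1 ^ k = 2`. Only `y` and `z` may vanish, and
  -- they go to different triangular parts.
  obtain ⟨x, y, z, w, hx, hw, h⟩ := exists_four_pow_eq hk hkF hq (A.trace - 2 * n)
  let β : Fin (n + 2) → F := Fin.cons x (Fin.cons y fun _ => 1)
  let γ : Fin (n + 2) → F := Fin.cons z (Fin.cons w fun _ => 1)
  obtain ⟨P, hP⟩ := Matrix.exists_conj_diag_eq A hA (fun i => β i ^ k + γ i ^ k) (by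
    simp only [β, γ, Fin.sum_univ_succ, Fin.cons_zero, Fin.cons_succ, one_pow, Finset.sum_const,
      Finset.card_univ, Fintype.card_fin, nsmul_eq_mul]
    linear_combination h)
  obtain ⟨B, C, hBC⟩ := Matrix.eq_pow_add_pow_of_diag_eq hkF _ β γ 1 0
    (Fin.cases (fun _ => hx) (Fin.cases (fun h => absurd rfl h) fun _ _ => one_ne_zero))
    (Fin.cases (fun h => absurd rfl h) (Fin.cases (fun _ => hw) fun _ _ => one_ne_zero)) hP
  refine ⟨P⁻¹.val * B * P.val, P⁻¹.val * C * P.val, ?_⟩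
  rw [Units.conj_pow', Units.conj_pow', ← add_mul, ← mul_add, ← hBC]
  simp [mul_assoc]

theorem Matrix.exists_smul_one_eq_pow_add_pow {p : ℕ} [Fact p.Prime] [CharP F p] {n k : ℕ}
    (hn : 2 ≤ n) (hk : 2 ≤ k) (hq : (k - 1) ^ 3 < Fintype.card F) {a : F} (ha : a ≠ 0) :
    ∃ B C : Matrix (Fin n) (Fin n) F, a • 1 = B ^ k + C ^ k := by
  have : NeZero n := ⟨by omega⟩
  let K := FiniteField.Extension F p n
  have : Fintype K := Fintype.ofFinite K
  have hK : (((k : ℝ) - 1) ^ 4) < Fintype.card K := by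
    have h1 : (k - 1) ^ 4 < Fintype.card K := by
      rw [← Nat.card_eq_fintype_card, FiniteField.natCard_extension, Nat.card_eq_fintype_card]
      -- Here `n ≥ 2` lifts the cubic bound on `F` to the quartic one needed in `K`.
      calc (k - 1) ^ 4 ≤ ((k - 1) ^ 3) ^ 2 := by
            rw [← pow_mul]; exact Nat.pow_le_pow_right (by omega) (by norm_num)
        _ < Fintype.card F ^ 2 := Nat.pow_lt_pow_left hq (by norm_num)
        _ ≤ Fintype.card F ^ n := Nat.pow_le_pow_right Fintype.card_pos hn
    have : (((k - 1) ^ 4 : ℕ) : ℝ) < Fintype.card K := Nat.cast_lt.2 h1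
    rwa [Nat.cast_pow, Nat.cast_sub (by omega), Nat.cast_one] at this
  obtain ⟨x, y, hxy⟩ := exists_pow_add_pow_eq (by omega) hK
    ((map_ne_zero (algebraMap F K)).2 ha)
  let b : Module.Basis (Fin n) F K :=
    Module.finBasisOfFinrankEq F K (FiniteField.finrank_extension F p n)
  refine ⟨Algebra.leftMulMatrix b x, Algebra.leftMulMatrix b y, ?_⟩
  rw [← map_pow, ← map_pow, ← map_add, hxy, AlgHom.commutes, Algebra.algebraMap_eq_smul_one]

end Main

theorem corollary1p9 {F : Type*} [Field F] [Fintype F] (p : ℕ) [Fact p.Prime] [CharP F p]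
    (k n : ℕ) (hn : 2 ≤ n) (hpk : ¬ p ∣ k)
    (hq : (k : ℤ) ^ 3 - 3 * (k : ℤ) ^ 2 + 3 * (k : ℤ) ≤ (Fintype.card F : ℤ))
    (A : Matrix (Fin n) (Fin n) F) :
    ∃ B C : Matrix (Fin n) (Fin n) F, A = B ^ k + C ^ k := by
  have hkF : (k : F) ≠ 0 := by rwa [Ne, CharP.cast_eq_zero_iff F p]
  have hk0 : k ≠ 0 := by rintro rfl; simp at hkF
  rcases eq_or_ne k 1 with rfl | hk1
  · exact ⟨A, 0, by simp⟩
  have hk : 2 ≤ k := by omega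
  have hq' : (k - 1) ^ 3 < Fintype.card F := by
    zify [show 1 ≤ k by omega]
    linarith [show ((k : ℤ) - 1) ^ 3 = (k : ℤ) ^ 3 - 3 * (k : ℤ) ^ 2 + 3 * (k : ℤ) - 1 by ring]
  by_cases hA : ∃ a : F, A = a • 1
  · obtain ⟨a, rfl⟩ := hA
    rcases eq_or_ne a 0 with rfl | ha
    · exact ⟨0, 0, by simp [hk0]⟩
    · exact Matrix.exists_smul_one_eq_pow_add_pow (p := p) hn hk hq' ha
  · push Not at hA
    obtain ⟨m, rfl⟩ : ∃ m, n = m + 2 := ⟨n - 2, by omega⟩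
    exact Matrix.exists_eq_pow_add_pow_of_not_scalar hk hkF hq' A hA
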